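/- A hypergraph $\mathcal H$ on a finite set $V$ is a finite family of subsets (edges) of $V$, repeated edges being allowed; $|\mathcal H|$ and all counts of edges below are with multiplicity. For $A\subseteq V$ let $d(A)$ be the number of edges of $\mathcal H$ containing $A$, and let $M_j(A)=|\{S\in\mathcal H: |A\cap S|\ge j\}|$. Let $0<q\le 1$ be real and let $r_1>\cdots>r_k$ be positive integers. Say that $\mathcal H$ is $(q;r_1,\ldots,r_k)$-spread if $\mathcal H$ is non-empty, every edge has at most $r_1$ vertices, and for all $A\subseteq V$ with $d(A)>0$ and $r_i\ge |A|\ge r_{i+1}$ for some $1\le i<k$, we have $M_j(A)\le q^j|\mathcal H|$ for all integers $j\ge r_{i+1}$. **Theorem.** There is an absolute constant $K_0>0$ with the following property. Let $\ell\ge 1$, let $\mathcal H$ be a hypergraph on $V$ that is $r_1$-uniform (every edge has exactly $r_1$ vertices) and $(q;r_1,\ldots,r_\ell,1)$-spread, where $r_1>\cdots>r_\ell>1$, and let $C\ge K_0$ be real. Let $W$ be chosen uniformly at random among the subsets of $V$ of size $C\ell q|V|$; if this number is not an integer it may be rounded either up or down, that is, $|W|=m$ for any integer $0\le m\le|V|$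 with $\bigl|m-C\ell q|V|\bigr|<1$. Then $$\Pr[W\text{ contains an edge of }\mathcal H]\ \ge\ 1-\frac{K_0}{C\ell}.$$ -/

import Mathlib

/-- A hypergraph on the finite vertex set `V`, with repeated edges allowed, is a finite indexed
family `H : ι → Finset V`; the number of its edges, counted with multiplicity, is
`Fintype.card ι`.

`edgeDegree H A` is the number of edges containing `A`, counted with multiplicity. -/
def edgeDegree {ι V : Type*} [Fintype ι] [DecidableEq V] (H : ι → Finset V) (A : Finset V) : ℕ :=
  (Finset.univ.filter fun e : ι => A ⊆ H e).card

/-- `meetCount H j A` is the number, counted with multiplicity, of edges of `H` that meet `A` in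
at least `j` vertices. -/
def meetCount {ι V : Type*} [Fintype ι] [DecidableEq V] (H : ι → Finset V) (j : ℕ)
    (A : Finset V) : ℕ :=
  (Finset.univ.filter fun e : ι => j ≤ (A ∩ H e).card).card

/-- Every edge of `H` has exactly `r` vertices. -/
def IsUniformHypergraph {ι V : Type*} (H : ι → Finset V) (r : ℕ) : Prop :=
  ∀ e, (H e).card = r

/-- Every edge of `H` has at most `r` vertices. -/
def IsBoundedHypergraph {ι V : Type*} (H : ι → Finset V) (r : ℕ) : Prop :=
  ∀ e, (H e).card ≤ r

/-- `H` is `(q; r 0, r 1, …, r k)`-spread, where `0 < q ≤ 1` and `r 0 > r 1 > ⋯ > r k` are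
positive integers. -/
structure IsSpreadHypergraph {ι V : Type*} [Fintype ι] [DecidableEq V] (H : ι → Finset V)
    (q : ℝ) {k : ℕ} (r : Fin (k + 1) → ℕ) : Prop where
  q_pos : 0 < q
  q_le_one : q ≤ 1
  strictAnti : StrictAnti r
  pos : ∀ i, 0 < r i
  nonempty : Nonempty ι
  bounded : IsBoundedHypergraph H (r 0)
  spread : ∀ (A : Finset V), 0 < edgeDegree H A →
    ∀ i : Fin k, A.card ≤ r i.castSucc → r i.succ ≤ A.card →
      ∀ j : ℕ, r i.succ ≤ j → (meetCount H j A : ℝ) ≤ q ^ j * (Fintype.card ι : ℝ)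

/-- The probability that a uniformly random `m`-element subset `W` of `V` contains an edge of `H`
(meaningful for `m ≤ |V|`). -/
noncomputable def probContainsEdge {ι V : Type*} [Fintype ι] [Fintype V] [DecidableEq V]
    (H : ι → Finset V) (m : ℕ) : ℝ :=
  (((Finset.powersetCard m (Finset.univ : Finset V)).filter fun W => ∃ e, H e ⊆ W).card : ℝ) /
    ((Finset.powersetCard m (Finset.univ : Finset V)).card : ℝ)

open Finset

/-! Write the spread parameters in increasing order as ρ 0 = 1 < ρ 1 < ... < ρ ℓ, and let N be the
number of edges of `H`. The random set is exposed in ℓ independent binomial rounds, numbered from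
the end. Round t > 0 starts with sub-edges of size at most ρ (t+1), and shrinks all but a few of
them to fragments of size at most ρ t: if the random set W together with e contains an edge e' with
|e ∩ e'| ≤ ρ t, then e is replaced by e ∩ e'. Any set that contains this fragment completes e' when
joined to W, so it is enough to cover a fragment in the later rounds. Fragments keep the index of
their edge and lie inside it, so the spread condition on `H` still controls their overlaps.

An edge with no such e' is stuck. Given Z = e ∪ W, a stuck edge overlaps every edge inside Z in more
than ρ t vertices. Hence either Z carries little weight of edges, or its stuck weight is paid for by
pairs with large overlap, and spreadness makes those pairs rare (`bernoulliMean_stuck_le`). In round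
0 the spread condition holds for all overlaps j ≥ 1, and Chebyshev's inequality finishes
(`bernoulliMean_no_edge_mul_le`).

Round t has density c(1 + ℓ/2^t)q. These densities sum to at most 3cℓq, while the expected stuck
proportion in round t is at most 3/(2^t cℓ), because ρ t ≥ t + 1. The failure probabilities
therefore sum to O(1/(cℓ)). Monotonicity transfers the bound to sets of fixed size. -/

/-- The mean of `f W`, where `W` contains each vertex independently with probability `p`. -/
noncomputable def bernoulliMean {V : Type*} [Fintype V] (p : ℝ) (f : Finset V → ℝ) : ℝ :=
  ∑ W, p ^ W.card * (1 - p) ^ (Fintype.card V - W.card) * f W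

/-! ### Expectations over binomial random sets. -/

namespace bernoulliMean

variable {V : Type*} [Fintype V] {p : ℝ}

lemma mono (h0 : 0 ≤ p) (h1 : p ≤ 1) {f g : Finset V → ℝ} (h : ∀ W, f W ≤ g W) :
    bernoulliMean p f ≤ bernoulliMean p g :=
  sum_le_sum fun W _ => mul_le_mul_of_nonneg_left (h W)
    (mul_nonneg (pow_nonneg h0 _) (pow_nonneg (by linarith) _))

lemma add (f g : Finset V → ℝ) :
    bernoulliMean p (fun W => f W + g W) = bernoulliMean p f + bernoulliMean p g := by
  simp [bernoulliMean, mul_add, sum_add_distrib]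

lemma const_mul (c : ℝ) (f : Finset V → ℝ) :
    bernoulliMean p (fun W => c * f W) = c * bernoulliMean p f := by
  simp only [bernoulliMean, mul_sum]
  exact sum_congr rfl fun W _ => by ring

lemma finsetSum {α : Type*} (s : Finset α) (f : α → Finset V → ℝ) :
    bernoulliMean p (fun W => ∑ a ∈ s, f a W) = ∑ a ∈ s, bernoulliMean p (f a) := by
  simp only [bernoulliMean, mul_sum]
  exact sum_comm

lemma const (c : ℝ) : bernoulliMean (V := V) p (fun _ => c) = c := by
  have := Fintype.sum_pow_mul_eq_add_pow V p (1 - p)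
  simp [bernoulliMean, ← sum_mul, this]

variable [DecidableEq V]

lemma insert_vertex (a : V) (g : Finset V → ℝ) :
    p * bernoulliMean p (fun W => g (insert a W)) =
      bernoulliMean p (fun W => if a ∈ W then g W else 0) := by
  have hu : (univ : Finset (Finset V)) = (insert a (univ.erase a)).powerset := by
    rw [insert_erase (mem_univ a), powerset_univ]
  simp only [bernoulliMean]
  rw [hu, sum_powerset_insert (notMem_erase a univ), sum_powerset_insert (notMem_erase a univ),
    ← sum_add_distrib, ← sum_add_distrib, mul_sum]
  refine sum_congr rfl fun t ht => ?_
  have hat : a ∉ t := fun h => notMem_erase a univ (mem_powerset.1 ht h)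
  have hlt : t.card < Fintype.card V := by
    rw [← card_univ]
    exact card_lt_card (ssubset_univ_iff.2 fun h => hat (h ▸ mem_univ a))
  obtain ⟨k, hk⟩ : ∃ k, Fintype.card V - t.card = k + 1 :=
    ⟨Fintype.card V - t.card - 1, by omega⟩
  have hk' : Fintype.card V - (t.card + 1) = k := by omega
  simp only [insert_idem, hat, mem_insert_self, if_true, if_false, card_insert_of_notMem hat,
    hk, hk']
  ring

/-- Conditioned on containing S, a binomial set is distributed as S ∪ W. This change of measure
turns statements about e ∪ W into weighted counts of the edges inside a random Z. -/
lemma union_left (S : Finset V) (g : Finset V → ℝ) :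
    p ^ S.card * bernoulliMean p (fun W => g (S ∪ W)) =
      bernoulliMean p (fun W => if S ⊆ W then g W else 0) := by
  induction S using Finset.induction_on generalizing g with
  | empty => simp
  | insert a S ha ih =>
    have h1 := ih fun W => if a ∈ W then g W else 0
    have h2 := insert_vertex (p := p) a fun W => g (S ∪ W)
    have e1 : (fun W => g (insert a S ∪ W)) = fun W => g (S ∪ insert a W) := by
      funext W; congr 1; ext x; simp
    have e2 : (fun W => if insert a S ⊆ W then g W else 0) =
        fun W => if S ⊆ W then (if a ∈ W then g W else 0) else 0 := by
      funext W; simp only [insert_subset_iff]; split_ifs <;> tauto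
    have e3 : (fun W => if a ∈ W then g (S ∪ W) else 0) =
        fun W => if a ∈ S ∪ W then g (S ∪ W) else 0 := by
      funext W; simp [ha]
    rw [card_insert_of_notMem ha, e1, e2, ← h1, ← e3, ← h2]
    ring

lemma subset_indicator (S : Finset V) :
    bernoulliMean p (fun W => if S ⊆ W then (1 : ℝ) else 0) = p ^ S.card := by
  rw [← union_left S fun _ => 1, const, mul_one]

/-- The union of two independent random sets with densities `p` and `p'` is random with density
`p + p' - p * p'`. -/
lemma union {p' : ℝ} (hp' : p' ≠ 0) (f : Finset V → ℝ) :
    bernoulliMean p (fun W => bernoulliMean p' fun W' => f (W ∪ W')) =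
      bernoulliMean (p + p' - p * p') f := by
  have h : ∀ W : Finset V, bernoulliMean p' (fun W' => f (W ∪ W')) =
      ∑ Z : Finset V, (p'⁻¹) ^ W.card *
        (p' ^ Z.card * (1 - p') ^ (Fintype.card V - Z.card) * if W ⊆ Z then f Z else 0) := by
    intro W
    have := union_left (p := p') W f
    rw [bernoulliMean.eq_1 p' (fun Z => if W ⊆ Z then f Z else 0)] at this
    rw [← mul_sum, ← this, ← mul_assoc, ← mul_pow, inv_mul_cancel₀ hp', one_pow, one_mul]
  rw [bernoulliMean.eq_1 p]
  simp only [h, mul_sum]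
  rw [sum_comm, bernoulliMean]
  refine sum_congr rfl fun Z _ => ?_
  have hZ : Z.card ≤ Fintype.card V := card_le_univ Z
  -- For fixed Z, the sum over the possible first sets W ⊆ Z is a binomial expansion.
  have key := Finset.sum_pow_mul_eq_add_pow (p * p'⁻¹) (1 - p) Z
  have e : (p + p' - p * p') ^ Z.card * (1 - (p + p' - p * p')) ^ (Fintype.card V - Z.card)
      = (p * p'⁻¹ + (1 - p)) ^ Z.card * ((1 - p) ^ (Fintype.card V - Z.card) *
        (p' ^ Z.card * (1 - p') ^ (Fintype.card V - Z.card))) := by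
    have h1 : p + p' - p * p' = (p * p'⁻¹ + (1 - p)) * p' := by field_simp; ring
    have h2 : 1 - (p + p' - p * p') = (1 - p) * (1 - p') := by ring
    rw [h2, h1, mul_pow, mul_pow]; ring
  rw [e, ← key, sum_mul, sum_mul]
  have hsub : ∑ W ∈ Z.powerset, (p * p'⁻¹) ^ W.card * (1 - p) ^ (Z.card - W.card) *
      ((1 - p) ^ (Fintype.card V - Z.card) *
        (p' ^ Z.card * (1 - p') ^ (Fintype.card V - Z.card))) * f Z
      = ∑ W : Finset V, if W ⊆ Z then (p * p'⁻¹) ^ W.card * (1 - p) ^ (Z.card - W.card) *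
      ((1 - p) ^ (Fintype.card V - Z.card) *
        (p' ^ Z.card * (1 - p') ^ (Fintype.card V - Z.card))) * f Z else 0 := by
    rw [← sum_filter]
    congr 1
    ext W; simp
  rw [hsub]
  refine sum_congr rfl fun W _ => ?_
  by_cases hW : W ⊆ Z
  · have hc := card_le_card hW
    have : Fintype.card V - W.card = (Z.card - W.card) + (Fintype.card V - Z.card) := by omega
    simp only [hW, if_true, this, pow_add, mul_pow]
    ring
  · simp [hW]

lemma mul_indicators (hp : p ≠ 0) (A B : Finset V) :
    bernoulliMean p (fun W => (if A ⊆ W then (p⁻¹) ^ A.card else 0) *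
      (if B ⊆ W then (p⁻¹) ^ B.card else 0)) = (p⁻¹) ^ (A ∩ B).card := by
  have e : (fun W => (if A ⊆ W then (p⁻¹) ^ A.card else 0) *
      (if B ⊆ W then (p⁻¹) ^ B.card else 0)) =
      fun W => ((p⁻¹) ^ A.card * (p⁻¹) ^ B.card) * if A ∪ B ⊆ W then (1 : ℝ) else 0 := by
    funext W
    by_cases hA : A ⊆ W <;> by_cases hB : B ⊆ W <;> simp [hA, hB, union_subset_iff]
  rw [e, const_mul, subset_indicator, ← pow_add, ← card_union_add_card_inter, pow_add]
  have : (p⁻¹) ^ (A ∪ B).card * p ^ (A ∪ B).card = 1 := by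
    rw [← mul_pow, inv_mul_cancel₀ hp, one_pow]
  linear_combination (p⁻¹) ^ (A ∩ B).card * this

end bernoulliMean

/-! ### Overlaps, second moments and stuck edges. -/

section

variable {V ι : Type*} [Fintype V] [DecidableEq V]

/-- For fixed e, bound p⁻¹ to the power of the overlap by the sum of all (p⁻¹)^j with s ≤ j ≤
overlap. Counting the edges for each j leaves a geometric series of ratio q/p ≤ 1/2, whence the
factor 2. -/
lemma sum_inv_pow_overlap_le {F : ι → Finset V} {I : Finset ι} {p q N : ℝ} {s : ℕ}
    (hp : 0 < p) (hq : 0 ≤ q) (hqp : 2 * q ≤ p) (hN : 0 ≤ N)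
    (h : ∀ e ∈ I, ∀ j, s ≤ j →
      ((I.filter fun e' => j ≤ (F e ∩ F e').card).card : ℝ) ≤ q ^ j * N) :
    ∑ e ∈ I, ∑ e' ∈ I with s ≤ (F e ∩ F e').card, (p⁻¹) ^ (F e ∩ F e').card ≤
      I.card * (2 * N * (q / p) ^ s) := by
  have hp' : 0 ≤ p⁻¹ := inv_nonneg.2 hp.le
  have hy0 : 0 ≤ q / p := div_nonneg hq hp.le
  have hy : q / p ≤ 1 / 2 := by rw [div_le_iff₀ hp]; linarith
  rw [← nsmul_eq_mul]
  refine sum_le_card_nsmul _ _ _ fun e he => ?_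
  calc ∑ e' ∈ I with s ≤ (F e ∩ F e').card, (p⁻¹) ^ (F e ∩ F e').card
      ≤ ∑ e' ∈ I, ∑ j ∈ Ico s (Fintype.card V + 1),
          if j ≤ (F e ∩ F e').card then (p⁻¹) ^ j else 0 := by
        rw [sum_filter]
        refine sum_le_sum fun e' _ => ?_
        have hnn : ∀ j ∈ Ico s (Fintype.card V + 1),
            0 ≤ if j ≤ (F e ∩ F e').card then (p⁻¹) ^ j else 0 := fun j _ => by
          split_ifs <;> positivity
        split_ifs with hs
        · have := single_le_sum hnn
            (mem_Ico.2 ⟨hs, Nat.lt_succ_of_le (card_le_univ (F e ∩ F e'))⟩)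
          simpa using this
        · exact sum_nonneg hnn
    _ = ∑ j ∈ Ico s (Fintype.card V + 1),
          (p⁻¹) ^ j * ((I.filter fun e' => j ≤ (F e ∩ F e').card).card : ℝ) := by
        rw [sum_comm]
        refine sum_congr rfl fun j _ => ?_
        rw [← sum_filter, sum_const, nsmul_eq_mul, mul_comm]
    _ ≤ ∑ j ∈ Ico s (Fintype.card V + 1), (q / p) ^ j * N := by
        refine sum_le_sum fun j hj => ?_
        calc _ ≤ (p⁻¹) ^ j * (q ^ j * N) :=
              mul_le_mul_of_nonneg_left (h e he j (mem_Ico.1 hj).1) (by positivity)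
          _ = _ := by rw [div_eq_mul_inv, mul_pow]; ring
    _ = (∑ j ∈ Ico s (Fintype.card V + 1), (q / p) ^ j) * N := by rw [sum_mul]
    _ ≤ ((q / p) ^ s / (1 - q / p)) * N :=
        mul_le_mul_of_nonneg_right (geom_sum_Ico_le_of_lt_one hy0 (by linarith)) hN
    _ ≤ (2 * (q / p) ^ s) * N := by
        refine mul_le_mul_of_nonneg_right ?_ hN
        rw [div_le_iff₀ (by linarith)]
        nlinarith [pow_nonneg hy0 s]
    _ = _ := by ring

/-- The number of edges in a set, each edge weighted by the inverse of the probability that a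
random set of density `p` contains it. -/
noncomputable def weightedCount (F : ι → Finset V) (I : Finset ι) (p : ℝ) (W : Finset V) : ℝ :=
  ∑ e ∈ I, if F e ⊆ W then (p⁻¹) ^ (F e).card else 0

lemma bernoulliMean_weightedCount {F : ι → Finset V} {I : Finset ι} {p : ℝ} (hp : p ≠ 0) :
    bernoulliMean p (weightedCount F I p) = I.card := by
  have : weightedCount F I p = fun W => ∑ e ∈ I,
      (p⁻¹) ^ (F e).card * if F e ⊆ W then (1 : ℝ) else 0 := by
    funext W; simp [weightedCount]
  rw [this, bernoulliMean.finsetSum]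
  simp only [bernoulliMean.const_mul, bernoulliMean.subset_indicator]
  simp [hp]

lemma bernoulliMean_weightedCount_sq {F : ι → Finset V} {I : Finset ι} {p : ℝ} (hp : p ≠ 0) :
    bernoulliMean p (fun W => weightedCount F I p W ^ 2) =
      ∑ e ∈ I, ∑ e' ∈ I, (p⁻¹) ^ (F e ∩ F e').card := by
  have : (fun W => weightedCount F I p W ^ 2) = fun W => ∑ e ∈ I, ∑ e' ∈ I,
      (if F e ⊆ W then (p⁻¹) ^ (F e).card else 0) *
        (if F e' ⊆ W then (p⁻¹) ^ (F e').card else 0) := by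
    funext W; rw [weightedCount, sq, sum_mul_sum]
  rw [this, bernoulliMean.finsetSum]
  refine sum_congr rfl fun e _ => ?_
  rw [bernoulliMean.finsetSum]
  exact sum_congr rfl fun e' _ => bernoulliMean.mul_indicators hp _ _

/-- The variance of `weightedCount` is at most the contribution of intersecting pairs of edges. -/
lemma bernoulliMean_weightedCount_sub_sq_le {F : ι → Finset V} {I : Finset ι} {p : ℝ}
    (hp : 0 < p) :
    bernoulliMean p (fun W => (weightedCount F I p W - I.card) ^ 2) ≤
      ∑ e ∈ I, ∑ e' ∈ I with 1 ≤ (F e ∩ F e').card, (p⁻¹) ^ (F e ∩ F e').card := by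
  have e1 : (fun W => (weightedCount F I p W - I.card) ^ 2) = fun W =>
      weightedCount F I p W ^ 2 + ((-2 * I.card) * weightedCount F I p W + (I.card : ℝ) ^ 2) := by
    funext W; ring
  rw [e1, bernoulliMean.add, bernoulliMean.add, bernoulliMean.const_mul, bernoulliMean.const,
    bernoulliMean_weightedCount hp.ne', bernoulliMean_weightedCount_sq hp.ne']
  have e2 : ∑ e ∈ I, ∑ e' ∈ I, (p⁻¹) ^ (F e ∩ F e').card ≤
      ∑ e ∈ I, (∑ e' ∈ I with 1 ≤ (F e ∩ F e').card, (p⁻¹) ^ (F e ∩ F e').card + I.card) := by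
    refine sum_le_sum fun e _ => ?_
    have hc : (I.card : ℝ) = ∑ e' ∈ I, 1 := by simp
    rw [sum_filter, hc, ← sum_add_distrib]
    refine sum_le_sum fun e' _ => ?_
    split_ifs with h
    · linarith
    · have : (F e ∩ F e').card = 0 := by omega
      simp [this]
  rw [sum_add_distrib, sum_const, nsmul_eq_mul] at e2
  nlinarith

open Classical in
/-- A second moment bound for the probability of containing no edge. -/
lemma bernoulliMean_no_edge_mul_le {F : ι → Finset V} {I : Finset ι} {p q N : ℝ}
    (hp : 0 < p) (hp1 : p ≤ 1) (hq : 0 ≤ q) (hqp : 2 * q ≤ p) (hN : 0 ≤ N)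
    (h : ∀ e ∈ I, ∀ j, 1 ≤ j →
      ((I.filter fun e' => j ≤ (F e ∩ F e').card).card : ℝ) ≤ q ^ j * N) :
    bernoulliMean p (fun W => if ∀ e ∈ I, ¬ F e ⊆ W then (1 : ℝ) else 0) * I.card ≤
      2 * N * (q / p) := by
  rcases I.eq_empty_or_nonempty with rfl | hI
  · simp; positivity
  have hc : (0 : ℝ) < I.card := by exact_mod_cast hI.card_pos
  -- When no edge lies in W the weighted count is 0, so it deviates from its mean by the full |I|.
  have h1 : bernoulliMean p (fun W => (I.card : ℝ) ^ 2 *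
      if ∀ e ∈ I, ¬ F e ⊆ W then (1 : ℝ) else 0) ≤
      bernoulliMean p (fun W => (weightedCount F I p W - I.card) ^ 2) := by
    refine bernoulliMean.mono hp.le hp1 fun W => ?_
    split_ifs with hW
    · have : weightedCount F I p W = 0 := sum_eq_zero fun e he => if_neg (hW e he)
      rw [this]; apply le_of_eq; ring
    · rw [mul_zero]; positivity
  rw [bernoulliMean.const_mul] at h1
  have h2 := h1.trans ((bernoulliMean_weightedCount_sub_sq_le hp).trans
    (sum_inv_pow_overlap_le hp hq hqp hN h))
  rw [pow_one] at h2
  refine le_of_mul_le_mul_left ?_ hc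
  linarith

/-- An edge `e` is stuck in `Z` if every edge inside `Z` meets `e` in more than `s` vertices. -/
def IsStuck (F : ι → Finset V) (I : Finset ι) (s : ℕ) (Z : Finset V) (e : ι) : Prop :=
  ∀ e' ∈ I, F e' ⊆ Z → s < (F e ∩ F e').card

open Classical in
/-- On average few edges `e` are stuck in the union of `e` and a random set. -/
lemma bernoulliMean_stuck_le {F : ι → Finset V} {I : Finset ι} {p q N δ : ℝ} {s : ℕ}
    (hp : 0 < p) (hp1 : p ≤ 1) (hq : 0 ≤ q) (hqp : 2 * q ≤ p) (hN : 0 < N) (hδ : 0 < δ)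
    (hIN : (I.card : ℝ) ≤ N)
    (h : ∀ e ∈ I, ∀ j, s + 1 ≤ j →
      ((I.filter fun e' => j ≤ (F e ∩ F e').card).card : ℝ) ≤ q ^ j * N) :
    bernoulliMean p (fun W => ((I.filter fun e => IsStuck F I s (F e ∪ W) e).card : ℝ)) ≤
      N * (δ + 2 * (q / p) ^ (s + 1) / δ) := by
  have hp' : 0 < p⁻¹ := inv_pos.2 hp
  let w : Finset V → ι → ℝ := fun Z e => if F e ⊆ Z then (p⁻¹) ^ (F e).card else 0
  have hw : ∀ Z e, 0 ≤ w Z e := fun Z e => by simp only [w]; split_ifs <;> positivity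
  -- `b` is the stuck weight inside Z, and `d` the weight of ordered pairs overlapping in more than
  -- s vertices.
  let b : Finset V → ℝ := fun Z => ∑ e ∈ I with IsStuck F I s Z e, w Z e
  let d : Finset V → ℝ := fun Z =>
    ∑ e ∈ I, ∑ e' ∈ I with s + 1 ≤ (F e ∩ F e').card, w Z e * w Z e'
  have h1 : bernoulliMean p
      (fun W => ((I.filter fun e => IsStuck F I s (F e ∪ W) e).card : ℝ)) =
      bernoulliMean p b := by
    have e1 : (fun W => ((I.filter fun e => IsStuck F I s (F e ∪ W) e).card : ℝ)) =
        fun W => ∑ e ∈ I, if IsStuck F I s (F e ∪ W) e then (1 : ℝ) else 0 := by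
      funext W; simp
    have e2 : b = fun Z => ∑ e ∈ I, (p⁻¹) ^ (F e).card *
        if F e ⊆ Z then (if IsStuck F I s Z e then (1 : ℝ) else 0) else 0 := by
      funext Z
      simp only [b, sum_filter, w]
      exact sum_congr rfl fun e _ => by split_ifs <;> simp
    rw [e1, e2, bernoulliMean.finsetSum, bernoulliMean.finsetSum]
    refine sum_congr rfl fun e _ => ?_
    rw [bernoulliMean.const_mul,
      ← bernoulliMean.union_left (F e) fun Z => if IsStuck F I s Z e then (1 : ℝ) else 0,
      ← mul_assoc, ← mul_pow, inv_mul_cancel₀ hp.ne', one_pow, one_mul]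
  have hd : bernoulliMean p d ≤ N * (2 * N * (q / p) ^ (s + 1)) := by
    have : bernoulliMean p d = ∑ e ∈ I, ∑ e' ∈ I with s + 1 ≤ (F e ∩ F e').card,
        (p⁻¹) ^ (F e ∩ F e').card := by
      simp only [d]
      rw [bernoulliMean.finsetSum]
      refine sum_congr rfl fun e _ => ?_
      rw [bernoulliMean.finsetSum]
      exact sum_congr rfl fun e' _ => bernoulliMean.mul_indicators hp.ne' _ _
    rw [this]
    exact (sum_inv_pow_overlap_le hp hq hqp hN.le h).trans
      (mul_le_mul_of_nonneg_right hIN (by positivity))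
  have hb : ∀ Z, b Z ≤ δ * N + (δ * N)⁻¹ * d Z := by
    intro Z
    have hd0 : 0 ≤ d Z := sum_nonneg fun e _ => sum_nonneg fun e' _ => mul_nonneg (hw _ _) (hw _ _)
    have hby : b Z ≤ ∑ e ∈ I, w Z e :=
      sum_le_sum_of_subset_of_nonneg (filter_subset _ _) fun e _ _ => hw Z e
    -- A stuck edge paired with any edge inside Z is a pair counted by `d`.
    have hbd : b Z * ∑ e ∈ I, w Z e ≤ d Z := by
      rw [sum_mul_sum]
      calc _ ≤ ∑ e ∈ I with IsStuck F I s Z e,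
            ∑ e' ∈ I with s + 1 ≤ (F e ∩ F e').card, w Z e * w Z e' := by
            refine sum_le_sum fun e he => ?_
            rw [sum_filter]
            refine sum_le_sum fun e' he' => ?_
            split_ifs with hh
            · exact le_rfl
            · have : ¬ F e' ⊆ Z := fun hs => hh ((mem_filter.1 he).2 e' he' hs)
              simp [w, this]
        _ ≤ _ := sum_le_sum_of_subset_of_nonneg (filter_subset _ _) fun e _ _ =>
            sum_nonneg fun e' _ => mul_nonneg (hw _ _) (hw _ _)
    have hδN : 0 < δ * N := mul_pos hδ hN
    -- Total weight below δN bounds `b` directly; above δN, divide the preceding product inequality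
    -- by it.
    rcases le_total (∑ e ∈ I, w Z e) (δ * N) with hy | hy
    · have : 0 ≤ (δ * N)⁻¹ * d Z := by positivity
      linarith
    · have hb0 : 0 ≤ b Z := sum_nonneg fun e _ => hw Z e
      have : b Z ≤ (δ * N)⁻¹ * d Z := by
        rw [inv_mul_eq_div, le_div_iff₀ hδN]
        exact (mul_le_mul_of_nonneg_left hy hb0).trans hbd
      linarith
  rw [h1]
  refine (bernoulliMean.mono hp.le hp1 hb).trans ?_
  rw [bernoulliMean.add, bernoulliMean.const, bernoulliMean.const_mul]
  have : (δ * N)⁻¹ * bernoulliMean p d ≤ (δ * N)⁻¹ * (N * (2 * N * (q / p) ^ (s + 1))) :=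
    mul_le_mul_of_nonneg_left hd (by positivity)
  refine (add_le_add_right this _).trans (le_of_eq ?_)
  field_simp

end

/-! ### From binomial random sets to sets of fixed size. -/

section

variable {V : Type*} [Fintype V]

/-- The proportion of the sets of size `m` that satisfy `D`. -/
noncomputable def layerDensity (D : Finset V → Prop) [DecidablePred D] (m : ℕ) : ℝ :=
  (((powersetCard m (univ : Finset V)).filter D).card : ℝ) / (Fintype.card V).choose m

lemma layerDensity_le_one (D : Finset V → Prop) [DecidablePred D] (m : ℕ) :
    layerDensity D m ≤ 1 := by
  refine div_le_one_of_le₀ ?_ (by positivity)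
  have := card_filter_le (powersetCard m (univ : Finset V)) D
  rw [card_powersetCard, card_univ] at this
  exact_mod_cast this

variable [DecidableEq V]

/-- The shadow of a layer of a downward closed family lies in the family, so the local LYM
inequality applies. -/
lemma layerDensity_antitone {D : Finset V → Prop} [DecidablePred D]
    (hD : ∀ A B, A ⊆ B → D B → D A) : Antitone (layerDensity D) := by
  refine antitone_nat_of_succ_le fun k => ?_
  have hs : (((powersetCard (k + 1) (univ : Finset V)).filter D : Finset (Finset V)) :
      Set (Finset V)).Sized (k + 1) := fun A hA =>
    (mem_powersetCard.1 (mem_filter.1 (mem_coe.1 hA)).1).2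
  refine (local_lubell_yamamoto_meshalkin_inequality_div (𝕜 := ℝ) k.succ_ne_zero hs).trans ?_
  refine div_le_div_of_nonneg_right ?_ (by positivity)
  refine Nat.cast_le.2 (card_le_card fun A hA => ?_)
  obtain ⟨B, hB, a, ha, rfl⟩ := mem_shadow_iff.1 hA
  rw [mem_filter, mem_powersetCard] at hB ⊢
  refine ⟨⟨subset_univ _, ?_⟩, hD _ _ (erase_subset a B) hB.2⟩
  rw [card_erase_of_mem ha, hB.1.2]; rfl

/-- Comparison of the uniform model with the binomial model for a downward closed property. -/
lemma layerDensity_le_bernoulliMean_add {D : Finset V → Prop} [DecidablePred D]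
    (hD : ∀ A B, A ⊆ B → D B → D A) {p : ℝ} (h0 : 0 ≤ p) (h1 : p ≤ 1) (m : ℕ) :
    layerDensity D m ≤ bernoulliMean p (fun W => if D W then (1 : ℝ) else 0) +
      bernoulliMean p (fun W : Finset V => if m < W.card then (1 : ℝ) else 0) := by
  rw [← bernoulliMean.add, ← bernoulliMean.const (V := V) (p := p) (layerDensity D m)]
  simp only [bernoulliMean]
  rw [← powerset_univ, sum_powerset, sum_powerset]
  refine sum_le_sum fun k hk => ?_
  have hk' : k ≤ Fintype.card V := by
    rw [mem_range, card_univ] at hk; omega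
  have hch : (0 : ℝ) < (Fintype.card V).choose k := by exact_mod_cast Nat.choose_pos hk'
  have e : ∀ g : Finset V → ℝ, ∑ W ∈ powersetCard k (univ : Finset V),
      p ^ W.card * (1 - p) ^ (Fintype.card V - W.card) * g W =
      p ^ k * (1 - p) ^ (Fintype.card V - k) * ∑ W ∈ powersetCard k (univ : Finset V), g W := by
    intro g
    rw [mul_sum]
    refine sum_congr rfl fun W hW => ?_
    rw [(mem_powersetCard.1 hW).2]
  rw [e, e]
  refine mul_le_mul_of_nonneg_left ?_
    (mul_nonneg (pow_nonneg h0 _) (pow_nonneg (by linarith) _))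
  have e2 : ∑ W ∈ powersetCard k (univ : Finset V), (if m < W.card then (1 : ℝ) else 0) =
      if m < k then ((Fintype.card V).choose k : ℝ) else 0 := by
    rw [sum_congr rfl fun W hW => by rw [(mem_powersetCard.1 hW).2]]
    simp [card_powersetCard]
  rw [sum_add_distrib, e2, sum_const, card_powersetCard, card_univ, nsmul_eq_mul, sum_boole]
  -- Layers above m are paid for by the tail term; on the others the density is at least that of
  -- layer m.
  split_ifs with hmk
  · have := layerDensity_le_one D m
    have h3 : (0 : ℝ) ≤ ((powersetCard k (univ : Finset V)).filter D).card := by positivity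
    nlinarith
  · have := layerDensity_antitone hD (not_lt.1 hmk)
    rw [add_zero]
    refine (mul_le_mul_of_nonneg_left this hch.le).trans (le_of_eq ?_)
    rw [layerDensity, mul_div_cancel₀ _ hch.ne']

/-- Chebyshev's inequality for the size of a random set. -/
lemma bernoulliMean_card_gt_mul_le {p : ℝ} (h0 : 0 < p) (h1 : p ≤ 1) {m : ℕ}
    (hm : 2 * ((Fintype.card V : ℝ) * p) ≤ m) :
    bernoulliMean p (fun W : Finset V => if m < W.card then (1 : ℝ) else 0) *
      ((Fintype.card V : ℝ) * p) ≤ 1 := by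
  set n : ℝ := (Fintype.card V : ℝ) with hn
  have hn0 : 0 ≤ n := by positivity
  rcases hn0.eq_or_lt with h | hnpos
  · rw [← h]; simp
  have hY : ∀ W : Finset V,
      weightedCount (fun v : V => ({v} : Finset V)) univ p W = W.card * p⁻¹ := by
    intro W; simp [weightedCount]
  have hv := bernoulliMean_weightedCount_sub_sq_le (F := fun v : V => ({v} : Finset V))
    (I := univ) h0
  have hs : ∑ e : V, ∑ e' : V with 1 ≤ (({e} : Finset V) ∩ {e'}).card,
      (p⁻¹) ^ (({e} : Finset V) ∩ {e'}).card = n * p⁻¹ := by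
    have : ∀ e : V, (∑ e' : V with 1 ≤ (({e} : Finset V) ∩ {e'}).card,
        (p⁻¹) ^ (({e} : Finset V) ∩ {e'}).card) = p⁻¹ := by
      intro e
      have hf : (univ.filter fun e' : V => 1 ≤ (({e} : Finset V) ∩ {e'}).card) = {e} := by
        ext x
        by_cases hx : e = x
        · subst hx; simp
        · simp [Ne.symm hx]
      rw [hf, sum_singleton]; simp
    rw [sum_congr rfl fun e _ => this e]
    simp [hn]
  rw [hs] at hv
  have hle : bernoulliMean p (fun W : Finset V => n ^ 2 * if m < W.card then (1 : ℝ) else 0) ≤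
      n * p⁻¹ := by
    refine (bernoulliMean.mono h0.le h1 fun W => ?_).trans hv
    rw [hY, card_univ, ← hn]
    split_ifs with hW
    · have hW' : 2 * (n * p) ≤ W.card := hm.trans (by exact_mod_cast hW.le)
      have : n ≤ W.card * p⁻¹ - n := by
        rw [← div_eq_mul_inv, le_sub_iff_add_le, le_div_iff₀ h0]; linarith
      rw [mul_one]
      exact pow_le_pow_left₀ hn0 this 2
    · rw [mul_zero]; positivity
  rw [bernoulliMean.const_mul] at hle
  set x := bernoulliMean p (fun W : Finset V => if m < W.card then (1 : ℝ) else 0)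
  have := mul_le_mul_of_nonneg_right hle h0.le
  rw [mul_assoc n, inv_mul_cancel₀ h0.ne', mul_one] at this
  refine le_of_mul_le_mul_left ?_ hnpos
  linarith

end

/-! ### Fragments and the iteration over rounds. -/

section

variable {V ι : Type*} [DecidableEq V]

/-- The ratio between the density used in round `t`, counted from the end, and `q`. -/
noncomputable def roundFactor (c : ℝ) (ℓ t : ℕ) : ℝ := c * (1 + ℓ * (1 / 2) ^ t)

/-- Two of the factors give the inverse of the round factor, at most 2^t/(cℓ). Each of the other t
is at most 1/4, since c ≥ 16, and the product gains 4^(-t). -/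
lemma inv_sqrt_roundFactor_pow_le {c : ℝ} (hc : 16 ≤ c) {ℓ t s : ℕ} (hℓ : 1 ≤ ℓ)
    (hs : t + 2 ≤ s) : ((√(roundFactor c ℓ t))⁻¹) ^ s ≤ (1 / 2) ^ t / (c * ℓ) := by
  have hℓ' : (1 : ℝ) ≤ ℓ := by exact_mod_cast hℓ
  have hx : (0 : ℝ) < (1 / 2) ^ t := by positivity
  have hcβ : c ≤ roundFactor c ℓ t := by
    rw [roundFactor]; nlinarith [mul_pos (by linarith : (0 : ℝ) < ℓ) hx]
  have hB : 4 ≤ √(roundFactor c ℓ t) := Real.le_sqrt_of_sq_le (by linarith)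
  have hBinv : (√(roundFactor c ℓ t))⁻¹ ≤ 1 / 4 := by
    rw [one_div]; exact inv_anti₀ (by norm_num) hB
  have hB0 : 0 ≤ (√(roundFactor c ℓ t))⁻¹ := by positivity
  have hβ : c * ℓ * (1 / 2) ^ t ≤ roundFactor c ℓ t := by rw [roundFactor]; nlinarith
  calc ((√(roundFactor c ℓ t))⁻¹) ^ s ≤ ((√(roundFactor c ℓ t))⁻¹) ^ (t + 2) :=
        pow_le_pow_of_le_one hB0 (by linarith) hs
    _ = ((√(roundFactor c ℓ t))⁻¹) ^ t * (roundFactor c ℓ t)⁻¹ := by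
        rw [pow_add, inv_pow _ 2, Real.sq_sqrt (by linarith)]
    _ ≤ (1 / 4) ^ t * (c * ℓ * (1 / 2) ^ t)⁻¹ := by
        refine mul_le_mul (pow_le_pow_left₀ hB0 hBinv t) (inv_anti₀ (by positivity) hβ) ?_
          (by positivity)
        exact inv_nonneg.2 (by linarith)
    _ = (1 / 2) ^ t / (c * ℓ) := by
        have : ((1 : ℝ) / 4) ^ t = (1 / 2) ^ t * (1 / 2) ^ t := by
          rw [← mul_pow]; norm_num
        rw [this]; field_simp

open Classical in
/-- Replacing each edge that is not stuck by a fragment with at most `s` vertices. -/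
lemma exists_fragments {F : ι → Finset V} {I : Finset ι} (s : ℕ) (W : Finset V) :
    ∃ G : ι → Finset V, ∀ e ∈ I, ¬ IsStuck F I s (F e ∪ W) e →
      G e ⊆ F e ∧ (G e).card ≤ s ∧ ∃ e' ∈ I, F e' ⊆ W ∪ G e := by
  have : ∀ e, ∃ A : Finset V, e ∈ I → ¬ IsStuck F I s (F e ∪ W) e →
      A ⊆ F e ∧ A.card ≤ s ∧ ∃ e' ∈ I, F e' ⊆ W ∪ A := by
    intro e
    by_cases h : IsStuck F I s (F e ∪ W) e
    · exact ⟨∅, fun _ hn => absurd h hn⟩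
    · simp only [IsStuck, not_forall, not_lt] at h
      obtain ⟨e', he', hsub, hcard⟩ := h
      refine ⟨F e ∩ F e', fun _ _ => ⟨inter_subset_left, hcard, e', he', fun x hx => ?_⟩⟩
      have := hsub hx
      simp only [mem_union, mem_inter] at this ⊢
      tauto
  choose G hG using this
  exact ⟨G, hG⟩

variable [Fintype ι]

/-- Apply spreadness to A = F e, which lies in an edge of `H`. If |F e| < j no overlap reaches j, so
only sizes in the permitted range [a, b] matter. -/
lemma card_filter_overlap_le {H F : ι → Finset V} {I : Finset ι} {q : ℝ} (hq : 0 ≤ q)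
    {a b : ℕ} (hspread : ∀ A : Finset V, (∃ e, A ⊆ H e) → a ≤ A.card → A.card ≤ b →
      ∀ j, a ≤ j → (meetCount H j A : ℝ) ≤ q ^ j * Fintype.card ι)
    (hF : ∀ e ∈ I, F e ⊆ H e) (hb : ∀ e ∈ I, (F e).card ≤ b) :
    ∀ e ∈ I, ∀ j, a ≤ j →
      ((I.filter fun e' => j ≤ (F e ∩ F e').card).card : ℝ) ≤ q ^ j * Fintype.card ι := by
  intro e he j hj
  by_cases hje : j ≤ (F e).card
  · refine le_trans ?_ (hspread (F e) ⟨e, hF e he⟩ (hj.trans hje) (hb e he) j hj)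
    refine Nat.cast_le.2 (card_le_card fun e' he' => ?_)
    rw [mem_filter] at he' ⊢
    exact ⟨mem_univ _, he'.2.trans (card_le_card (inter_subset_inter_left (hF e' he'.1)))⟩
  · have : (I.filter fun e' => j ≤ (F e ∩ F e').card) = ∅ :=
      filter_eq_empty_iff.2 fun e' _ h => hje (h.trans (card_le_card inter_subset_left))
    rw [this]; simp; positivity

variable [Fintype V]

open Classical in
/-- The iteration: a random set of density about `c * ℓ * q` is unlikely to contain no edge of a
hypergraph formed by sub-edges of size at most `ρ (t + 1)`. -/
lemma exists_density_no_edge_le {H : ι → Finset V} {q c : ℝ} {ℓ : ℕ} {ρ : ℕ → ℕ} [Nonempty ι]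
    (hq : 0 < q) (hc : 16 ≤ c) (hρ0 : ρ 0 = 1) (hρ : ∀ t, t < ℓ → t + 1 ≤ ρ t)
    (hcq : 3 * c * ℓ * q ≤ 1)
    (hspread : ∀ t, t < ℓ → ∀ A : Finset V, (∃ e, A ⊆ H e) → ρ t ≤ A.card →
      A.card ≤ ρ (t + 1) → ∀ j, ρ t ≤ j → (meetCount H j A : ℝ) ≤ q ^ j * Fintype.card ι)
    (t : ℕ) (ht : t < ℓ) :
    ∃ P : ℝ, c * ℓ * q ≤ P ∧ P ≤ c * q * (t + 1 + ℓ * (2 - (1 / 2) ^ t)) ∧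
      ∀ (F : ι → Finset V) (I : Finset ι), (∀ e ∈ I, F e ⊆ H e) →
        (∀ e ∈ I, (F e).card ≤ ρ (t + 1)) →
        bernoulliMean P (fun W => if ∀ e ∈ I, ¬ F e ⊆ W then (1 : ℝ) else 0) ≤
          2 * (1 - I.card / Fintype.card ι) + (10 - 6 * (1 / 2) ^ t) / (c * ℓ) := by
  have hN : (0 : ℝ) < Fintype.card ι := by exact_mod_cast Fintype.card_pos
  have hℓ : 1 ≤ ℓ := by omega
  have hℓ' : (1 : ℝ) ≤ ℓ := by exact_mod_cast hℓ
  have hc0 : 0 < c := by linarith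
  have hcl : 0 < c * ℓ := by positivity
  have hround : ∀ u, 0 < roundFactor c ℓ u * q ∧ roundFactor c ℓ u * q ≤ 1 ∧
      2 * q ≤ roundFactor c ℓ u * q := by
    intro u
    have hx : (0 : ℝ) < (1 / 2) ^ u := by positivity
    have hx1 : ((1 : ℝ) / 2) ^ u ≤ 1 := pow_le_one₀ (by norm_num) (by norm_num)
    have h1 : c ≤ roundFactor c ℓ u := by
      rw [roundFactor]; nlinarith [mul_pos (by linarith : (0 : ℝ) < ℓ) hx]
    have h2 : roundFactor c ℓ u ≤ 3 * c * ℓ := by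
      rw [roundFactor]
      have : 1 + (ℓ : ℝ) * (1 / 2) ^ u ≤ 3 * ℓ := by nlinarith
      nlinarith
    exact ⟨mul_pos (by linarith) hq, (mul_le_mul_of_nonneg_right h2 hq.le).trans hcq,
      mul_le_mul_of_nonneg_right (by linarith) hq.le⟩
  have hcard : ∀ I : Finset ι, (I.card : ℝ) ≤ Fintype.card ι := fun I =>
    Nat.cast_le.2 (card_le_univ I)
  induction t with
  | zero =>
    obtain ⟨hp0, hp1, hqp⟩ := hround 0
    have hrf : roundFactor c ℓ 0 = c * (1 + ℓ) := by simp [roundFactor]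
    refine ⟨roundFactor c ℓ 0 * q, ?_, ?_, fun F I hF hb => ?_⟩
    · rw [hrf]; nlinarith
    · rw [hrf]; apply le_of_eq; push_cast; ring
    have h0 := hspread 0 ht
    rw [hρ0] at h0
    have key := bernoulliMean_no_edge_mul_le hp0 hp1 hq.le hqp hN.le
      (card_filter_overlap_le hq.le h0 hF hb)
    have hle1 : bernoulliMean (roundFactor c ℓ 0 * q)
        (fun W => if ∀ e ∈ I, ¬ F e ⊆ W then (1 : ℝ) else 0) ≤ 1 := by
      refine (bernoulliMean.mono hp0.le hp1 fun W => ?_).trans (bernoulliMean.const 1).le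
      split_ifs <;> norm_num
    have hle0 : 0 ≤ bernoulliMean (roundFactor c ℓ 0 * q)
        (fun W => if ∀ e ∈ I, ¬ F e ⊆ W then (1 : ℝ) else 0) := by
      refine (bernoulliMean.const 0).ge.trans (bernoulliMean.mono hp0.le hp1 fun W => ?_)
      split_ifs <;> norm_num
    set x := bernoulliMean (roundFactor c ℓ 0 * q)
        (fun W => if ∀ e ∈ I, ¬ F e ⊆ W then (1 : ℝ) else 0)
    set y : ℝ := I.card / Fintype.card ι with hy
    have hy1 : y ≤ 1 := div_le_one_of_le₀ (hcard I) hN.le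
    have hIy : (I.card : ℝ) = y * Fintype.card ι := by rw [hy]; field_simp
    have hqd : q / (roundFactor c ℓ 0 * q) ≤ 1 / (c * ℓ) := by
      rw [hrf, div_mul_cancel_right₀ hq.ne', ← one_div]
      exact one_div_le_one_div_of_le hcl (by nlinarith)
    have hxy : x * y ≤ 2 * (1 / (c * ℓ)) := by
      replace key : x * I.card ≤ 2 * Fintype.card ι * (q / (roundFactor c ℓ 0 * q)) := by
        convert key
      rw [hIy] at key
      refine le_trans ?_ (mul_le_mul_of_nonneg_left hqd zero_le_two)
      refine le_of_mul_le_mul_right ?_ hN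
      linarith
    have e4 : (10 - 6 * (1 / 2 : ℝ) ^ 0) / (c * ℓ) = 4 * (1 / (c * ℓ)) := by ring
    rw [e4]
    have hpos : 0 < 1 / (c * ℓ) := by positivity
    -- For y ≤ 1/2 the term 2(1 - y) is already at least 1; otherwise x ≤ 2xy.
    rcases le_total y (1 / 2) with h | h
    · linarith
    · nlinarith
  | succ t ih =>
    obtain ⟨P, hP1, hP2, hP⟩ := ih (by omega)
    obtain ⟨hp0, hp1, hqp⟩ := hround (t + 1)
    set p := roundFactor c ℓ (t + 1) * q with hp
    have hPpos : 0 < P := lt_of_lt_of_le (by positivity) hP1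
    have hP_le : P ≤ 1 := by
      refine hP2.trans (le_trans ?_ hcq)
      have htℓ : (t : ℝ) + 1 ≤ ℓ := by exact_mod_cast (by omega : t + 1 ≤ ℓ)
      have hx : (0 : ℝ) < (1 / 2) ^ t := by positivity
      have : (t : ℝ) + 1 + ℓ * (2 - (1 / 2) ^ t) ≤ 3 * ℓ := by nlinarith
      calc _ ≤ c * q * (3 * ℓ) := mul_le_mul_of_nonneg_left this (by positivity)
        _ = _ := by ring
    refine ⟨p + P - p * P, ?_, ?_, fun F I hF hb => ?_⟩
    · nlinarith
    · have : p + P ≤ c * q * (((t + 1 : ℕ) : ℝ) + 1 + ℓ * (2 - (1 / 2) ^ (t + 1))) := by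
        have e : p = c * q * (1 + ℓ * (1 / 2) ^ (t + 1)) := by rw [hp, roundFactor]; ring
        rw [e]
        refine (add_le_add_right hP2 _).trans (le_of_eq ?_)
        push_cast
        ring
      nlinarith [mul_pos hp0 hPpos]
    set s := ρ (t + 1) with hs
    have hst : t + 1 + 1 ≤ s := hρ (t + 1) ht
    have hov := card_filter_overlap_le hq.le (hspread (t + 1) ht) hF hb
    set β := roundFactor c ℓ (t + 1) with hβ
    have hβ0 : 0 < β := pos_of_mul_pos_left hp0 hq.le
    -- This δ is the square root of (q/p)^(s+1), which balances the two terms of the stuck bound to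
    -- a total of 3δ.
    have hδ : 0 < ((√β)⁻¹) ^ (s + 1) := by positivity
    have hstuck := bernoulliMean_stuck_le (s := s) hp0 hp1 hq.le hqp hN hδ (hcard I)
      fun e he j hj => hov e he j (by omega)
    have hδe : (q / p) ^ (s + 1) = ((√β)⁻¹) ^ (s + 1) * ((√β)⁻¹) ^ (s + 1) := by
      rw [hp, div_mul_cancel_right₀ hq.ne', ← mul_pow, ← mul_inv, Real.mul_self_sqrt hβ0.le]
    have hδle : ((√β)⁻¹) ^ (s + 1) ≤ (1 / 2) ^ (t + 1) / (c * ℓ) :=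
      inv_sqrt_roundFactor_pow_le hc hℓ (by omega)
    set δ := ((√β)⁻¹) ^ (s + 1)
    have hstuck' : bernoulliMean p
        (fun W => ((I.filter fun e => IsStuck F I s (F e ∪ W) e).card : ℝ)) ≤
        Fintype.card ι * (3 * ((1 / 2) ^ (t + 1) / (c * ℓ))) := by
      refine hstuck.trans (mul_le_mul_of_nonneg_left ?_ hN.le)
      rw [hδe, ← mul_assoc, mul_div_cancel_right₀ _ hδ.ne']
      linarith
    rw [← bernoulliMean.union hPpos.ne']
    set K := 2 * (1 - I.card / (Fintype.card ι : ℝ)) + (10 - 6 * (1 / 2) ^ t) / (c * ℓ) with hK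
    -- With W fixed, the induction hypothesis is applied to the fragments of the edges that are not
    -- stuck; each stuck edge costs 2/N.
    have hpt : ∀ W : Finset V, bernoulliMean P
        (fun W' => if ∀ e ∈ I, ¬ F e ⊆ W ∪ W' then (1 : ℝ) else 0) ≤
        K + (2 / (Fintype.card ι : ℝ)) *
          ((I.filter fun e => IsStuck F I s (F e ∪ W) e).card : ℝ) := by
      intro W
      obtain ⟨G, hG⟩ := exists_fragments (F := F) (I := I) s W
      have h2 := hP G (I.filter fun e => ¬ IsStuck F I s (F e ∪ W) e)
        (fun e he => ((hG e (mem_filter.1 he).1 (mem_filter.1 he).2).1).trans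
          (hF e (mem_filter.1 he).1))
        (fun e he => (hG e (mem_filter.1 he).1 (mem_filter.1 he).2).2.1)
      have hsum : ((I.filter fun e => IsStuck F I s (F e ∪ W) e).card : ℝ) +
          (I.filter fun e => ¬ IsStuck F I s (F e ∪ W) e).card = I.card := by
        exact_mod_cast card_filter_add_card_filter_not (s := I)
          (fun e => IsStuck F I s (F e ∪ W) e)
      refine le_trans (bernoulliMean.mono hPpos.le hP_le fun W' => ?_) (h2.trans (le_of_eq ?_))
      · by_cases h : ∀ e ∈ I, ¬ F e ⊆ W ∪ W'
        · rw [if_pos h, if_pos]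
          intro e he hsub
          obtain ⟨e', he', hsub'⟩ := (hG e (mem_filter.1 he).1 (mem_filter.1 he).2).2.2
          exact h e' he' (hsub'.trans (union_subset_union_right hsub))
        · rw [if_neg h]; split_ifs <;> norm_num
      · rw [hK, ← hsum]; ring
    refine (bernoulliMean.mono hp0.le hp1 hpt).trans ?_
    rw [bernoulliMean.add, bernoulliMean.const, bernoulliMean.const_mul]
    have h3 := mul_le_mul_of_nonneg_left hstuck'
      (by positivity : (0 : ℝ) ≤ 2 / (Fintype.card ι : ℝ))
    have h4 : 2 / (Fintype.card ι : ℝ) *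
        (Fintype.card ι * (3 * ((1 / 2) ^ (t + 1) / (c * ℓ)))) =
        6 * ((1 / 2) ^ (t + 1) / (c * ℓ)) := by
      field_simp; norm_num
    rw [h4] at h3
    refine (add_le_add_right h3 _).trans (le_of_eq ?_)
    rw [hK, pow_succ]
    ring

end

/-! ### Choice of constants and conclusion. -/

section

variable {V ι : Type*} [Fintype V] [DecidableEq V] [Fintype ι]

open Classical in
lemma probContainsEdge_eq_one_sub {H : ι → Finset V} {m : ℕ} (hm : m ≤ Fintype.card V) :
    probContainsEdge H m = 1 - layerDensity (fun W => ∀ e, ¬ H e ⊆ W) m := by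
  have hch : (0 : ℝ) < (Fintype.card V).choose m := by exact_mod_cast Nat.choose_pos hm
  have h := card_filter_add_card_filter_not (s := powersetCard m (univ : Finset V))
    (fun W => ∃ e, H e ⊆ W)
  simp only [not_exists] at h
  rw [card_powersetCard, card_univ] at h
  have h' : (((powersetCard m (univ : Finset V)).filter fun W => ∃ e, H e ⊆ W).card : ℝ) +
      ((powersetCard m (univ : Finset V)).filter fun W => ∀ e, ¬ H e ⊆ W).card =
      (Fintype.card V).choose m := by exact_mod_cast h
  rw [probContainsEdge, layerDensity, card_powersetCard, card_univ, eq_sub_iff_add_eq,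
    ← div_self hch.ne', ← h', add_div]

/-- Double counting of the pairs consisting of an edge and one of its vertices. -/
lemma uniformity_le_mul_card {H : ι → Finset V} {q : ℝ} {r : ℕ} [Nonempty ι] (hq : 0 ≤ q)
    (hr : IsUniformHypergraph H r)
    (h : ∀ v, (∃ e, {v} ⊆ H e) → (meetCount H 1 {v} : ℝ) ≤ q * Fintype.card ι) :
    (r : ℝ) ≤ q * Fintype.card V := by
  have hN : (0 : ℝ) < Fintype.card ι := by exact_mod_cast Fintype.card_pos
  have hcount : ∑ e, (H e).card = ∑ v : V, (univ.filter fun e => v ∈ H e).card := by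
    simp only [card_eq_sum_ones, sum_filter]
    rw [sum_comm]
    simp
  have hv : ∀ v : V, ((univ.filter fun e => v ∈ H e).card : ℝ) ≤ q * Fintype.card ι := by
    intro v
    by_cases hv : ∃ e, v ∈ H e
    · refine le_trans (Nat.cast_le.2 (card_le_card fun e he => ?_))
        (h v (by simpa using hv))
      rw [mem_filter] at he ⊢
      refine ⟨mem_univ _, ?_⟩
      rw [singleton_inter_of_mem he.2, card_singleton]
    · push Not at hv
      simp [hv]
      positivity
  have : (r : ℝ) * Fintype.card ι ≤ (q * Fintype.card V) * Fintype.card ι := by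
    calc (r : ℝ) * Fintype.card ι = ((∑ e, (H e).card : ℕ) : ℝ) := by
          simp only [hr _]; simp [mul_comm]
      _ = ∑ v : V, ((univ.filter fun e => v ∈ H e).card : ℝ) := by
          rw [hcount]; push_cast; rfl
      _ ≤ ∑ _v : V, q * Fintype.card ι := sum_le_sum fun v _ => hv v
      _ = _ := by simp; ring
  exact le_of_mul_le_mul_right this hN

open Classical in
/-- The theorem with an explicit constant, for spread parameters listed in increasing order. -/
lemma layerDensity_no_edge_le {H : ι → Finset V} {q C : ℝ} {ℓ m : ℕ} {ρ : ℕ → ℕ} [Nonempty ι]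
    (hq : 0 < q) (hℓ : 1 ≤ ℓ) (hC : 200 ≤ C) (hρ0 : ρ 0 = 1)
    (hρ : ∀ t, t ≤ ℓ → t + 1 ≤ ρ t) (hH : IsUniformHypergraph H (ρ ℓ))
    (hspread : ∀ t, t < ℓ → ∀ A : Finset V, (∃ e, A ⊆ H e) → ρ t ≤ A.card →
      A.card ≤ ρ (t + 1) → ∀ j, ρ t ≤ j → (meetCount H j A : ℝ) ≤ q ^ j * Fintype.card ι)
    (hm : m ≤ Fintype.card V) (hmC : |(m : ℝ) - C * ℓ * q * Fintype.card V| < 1) :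
    layerDensity (fun W => ∀ e, ¬ H e ⊆ W) m ≤ 200 / (C * ℓ) := by
  set n : ℝ := (Fintype.card V : ℝ) with hn
  have hℓ' : (1 : ℝ) ≤ ℓ := by exact_mod_cast hℓ
  -- Since edges have at least 2 vertices, the expected sizes are large enough to absorb the
  -- rounding of m.
  have hqn : 2 ≤ q * n := by
    have h1 : ((ρ ℓ : ℕ) : ℝ) ≤ q * n := by
      refine uniformity_le_mul_card hq.le hH fun v hv => ?_
      have := hspread 0 (by omega) {v} hv (by simp [hρ0])
        (by rw [card_singleton]; have : 1 + 1 ≤ ρ (0 + 1) := hρ 1 hℓ; omega) 1 hρ0.le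
      simpa using this
    have h2 : (2 : ℝ) ≤ (ρ ℓ : ℕ) := by
      have := hρ ℓ le_rfl
      exact_mod_cast (by omega : 2 ≤ ρ ℓ)
    linarith
  have hmn : (m : ℝ) ≤ n := Nat.cast_le.2 hm
  obtain ⟨hm1, hm2⟩ := abs_lt.1 hmC
  have hCl : 200 ≤ C * ℓ := by nlinarith
  have hbig : 400 ≤ C * ℓ * (q * n) := by nlinarith
  have hn1 : 0 < n := pos_of_mul_pos_right (by linarith : 0 < q * n) hq.le
  have hn2 : 1 ≤ n := by
    rw [hn] at hn1 ⊢
    exact_mod_cast hn1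
  have hCq : C * ℓ * q ≤ 2 := by
    refine le_of_mul_le_mul_right ?_ hn1
    linarith
  -- With c = C/12 the total density is at most Cℓq/4, so that m is at least twice the mean size, as
  -- the tail bound requires.
  obtain ⟨P, hP1, hP2, hP⟩ := exists_density_no_edge_le (H := H) (c := C / 12) hq (by linarith)
    hρ0 (fun t ht => hρ t ht.le) (by nlinarith) hspread (ℓ - 1) (by omega)
  have hPpos : 0 < P := lt_of_lt_of_le (by positivity) hP1
  have hP3 : P ≤ C * ℓ * q / 4 := by
    refine hP2.trans ?_
    have hx : (0 : ℝ) < (1 / 2) ^ (ℓ - 1) := by positivity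
    have e : ((ℓ - 1 : ℕ) : ℝ) + 1 = ℓ := by exact_mod_cast (by omega : ℓ - 1 + 1 = ℓ)
    rw [e]
    have : (ℓ : ℝ) + ℓ * (2 - (1 / 2) ^ (ℓ - 1)) ≤ 3 * ℓ := by nlinarith
    calc _ ≤ C / 12 * q * (3 * ℓ) := mul_le_mul_of_nonneg_left this (by positivity)
      _ = _ := by ring
  have hmain := hP H univ (fun e _ => Subset.rfl) fun e _ => by
    rw [hH e, Nat.sub_add_cancel hℓ]
  have htail := bernoulliMean_card_gt_mul_le (V := V) hPpos (by linarith) (m := m) (by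
    rw [← hn]
    nlinarith [mul_le_mul_of_nonneg_left hP3 hn1.le])
  have hcomp := layerDensity_le_bernoulliMean_add (D := fun W : Finset V => ∀ e, ¬ H e ⊆ W)
    (fun A B hAB hB e he => hB e (he.trans hAB)) hPpos.le (by linarith) m
  refine hcomp.trans ?_
  have hCl0 : 0 < C * ℓ := by linarith
  have hmain' : bernoulliMean P (fun W : Finset V => if ∀ e, ¬ H e ⊆ W then (1 : ℝ) else 0) ≤
      120 / (C * ℓ) := by
    have hN : (Fintype.card ι : ℝ) ≠ 0 := by exact_mod_cast Fintype.card_ne_zero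
    simp only [mem_univ, true_imp_iff, card_univ, div_self hN, sub_self, mul_zero,
      zero_add] at hmain
    refine hmain.trans ?_
    have hx : (0 : ℝ) < (1 / 2) ^ (ℓ - 1) := by positivity
    have e : C / 12 * (ℓ : ℝ) = C * ℓ / 12 := by ring
    rw [e, div_div_eq_mul_div]
    exact div_le_div_of_nonneg_right (by linarith) hCl0.le
  have htail' : bernoulliMean P (fun W : Finset V => if m < W.card then (1 : ℝ) else 0) ≤
      6 / (C * ℓ) := by
    set x := bernoulliMean P (fun W : Finset V => if m < W.card then (1 : ℝ) else 0)
    rw [← hn] at htail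
    rcases le_total x 0 with hx | hx
    · exact hx.trans (by positivity)
    rw [le_div_iff₀ hCl0]
    have h1 : C * ℓ / 6 ≤ n * P := by
      have h2 : C / 12 * ℓ * q * n ≤ P * n := mul_le_mul_of_nonneg_right hP1 hn1.le
      nlinarith
    nlinarith [mul_le_mul_of_nonneg_left h1 hx]
  calc _ ≤ 120 / (C * ℓ) + 6 / (C * ℓ) := add_le_add hmain' htail'
    _ = 126 / (C * ℓ) := by ring
    _ ≤ 200 / (C * ℓ) := div_le_div_of_nonneg_right (by norm_num) hCl0.le

/-- Reversing the indices makes the parameters increase from 1, hence by at least 1 at each step;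
this growth makes the stuck bounds summable. -/
lemma le_apply_sub_of_strictAnti {ℓ : ℕ} {r : Fin (ℓ + 1) → ℕ} (hr : StrictAnti r)
    (h1 : r (Fin.last ℓ) = 1) (t : ℕ) (ht : t ≤ ℓ) : t + 1 ≤ r ⟨ℓ - t, by omega⟩ := by
  induction t with
  | zero => exact h1.ge
  | succ t ih =>
    have h2 := ih (by omega)
    have h3 : r ⟨ℓ - t, by omega⟩ < r ⟨ℓ - (t + 1), by omega⟩ := hr (by
      rw [Fin.mk_lt_mk]; omega)
    omega

end

theorem mainTheorem1 :
    ∃ K₀ : ℝ, 0 < K₀ ∧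
      ∀ (V ι : Type*) [Fintype V] [DecidableEq V] [Fintype ι] (H : ι → Finset V)
        (q : ℝ) (ℓ : ℕ) (r : Fin (ℓ + 1) → ℕ),
        1 ≤ ℓ → r (Fin.last ℓ) = 1 →
        IsUniformHypergraph H (r 0) → IsSpreadHypergraph H q r →
        ∀ C : ℝ, K₀ ≤ C →
        ∀ m : ℕ, m ≤ Fintype.card V → |(m : ℝ) - C * ℓ * q * Fintype.card V| < 1 →
          1 - K₀ / (C * ℓ) ≤ probContainsEdge H m := by
  refine ⟨200, by norm_num, ?_⟩
  intro V ι _ _ _ H q ℓ r hℓ hlast hunif hspread C hC m hm hmC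
  have := hspread.nonempty
  rw [probContainsEdge_eq_one_sub hm]
  refine sub_le_sub_left ?_ 1
  refine layerDensity_no_edge_le (ρ := fun t => r ⟨ℓ - t, by omega⟩) hspread.q_pos hℓ hC hlast
    (le_apply_sub_of_strictAnti hspread.strictAnti hlast) ?_ ?_ hm hmC
  · simpa using hunif
  · intro t ht A hA h1 h2 j hj
    have e1 : Fin.succ (⟨ℓ - (t + 1), by omega⟩ : Fin ℓ) = ⟨ℓ - t, by omega⟩ :=
      Fin.ext (by simp only [Fin.val_succ]; omega)
    refine hspread.spread A ?_ ⟨ℓ - (t + 1), by omega⟩ h2 (by rw [e1]; exact h1) j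
      (by rw [e1]; exact hj)
    obtain ⟨e, he⟩ := hA
    exact card_pos.2 ⟨e, mem_filter.2 ⟨mem_univ _, he⟩⟩
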